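/- A planar map is a proper embedding of a connected graph (loops and multiple edges allowed) in the two-dimensional sphere, considered up to continuous deformation; it is rooted if one edge is distinguished as the root and given an orientation. A rooted map is a triangulation if all its faces have degree $3$, and it is non-separable if it has no loop and the deletion of any vertex does not disconnect it. The number of edges of a triangulation is a multiple of $3$; the generating function of a set of rooted triangulations is $\sum_{n} a_n t^n$, where $a_n$ is the number of its members with $3n$ edges. Let $\mathbf{G}$ be the set of non-separable rooted triangulations in which every vertex not incident to the root (that is, every vertex other than the two endpoints of the root edge) has degree at least $3$, and let $\mathbf{G}^*$ be the set of non-separable rooted triangulations in which every vertex has degree at least $3$. Let $\mathbb{G}(t)$ and $\mathbb{G}^*(t)$ be their generating functions. Then $$\mathbb{G}^*(t)=(1-2t)\,\mathbb{G}(t).$$ -/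

import Mathlib

/-! Rooted planar maps, encoded as combinatorial maps: an edge is cut into two darts (oriented
edges), a permutation `σ` turns each dart counterclockwise to the next dart with the same origin,
and an involution `α` reverses each dart.  Loops and multiple edges are allowed. -/

/-- A combinatorial map with dart set `D` and a distinguished dart, the root (an oriented edge). -/
structure RootedCombMap (D : Type) where
  /-- next dart counterclockwise around the common origin -/
  σ : Equiv.Perm D
  /-- reversal of darts -/
  α : Equiv.Perm D
  α_α : ∀ d, α (α d) = d
  α_ne : ∀ d, α d ≠ d
  root : D

namespace RootedCombMap

variable {D : Type} (M : RootedCombMap D)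

/-- Follow a dart to its end and leave by the next dart counterclockwise from its reversal:
the next dart along the face on the right of the dart. -/
def φ : Equiv.Perm D := M.σ * M.α

/-- Vertices: cycles of `σ`. -/
def Vertex : Type := Quotient (Equiv.Perm.SameCycle.setoid M.σ)

/-- Edges: cycles of `α`. -/
def Edge : Type := Quotient (Equiv.Perm.SameCycle.setoid M.α)

/-- Faces: cycles of `φ`. -/
def Face : Type := Quotient (Equiv.Perm.SameCycle.setoid M.φ)

/-- The origin of a dart. -/
def origin (d : D) : M.Vertex := Quotient.mk (Equiv.Perm.SameCycle.setoid M.σ) d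

/-- The end of a dart. -/
def target (d : D) : M.Vertex := M.origin (M.α d)

/-- The face on the right of a dart. -/
def rightFace (d : D) : M.Face := Quotient.mk (Equiv.Perm.SameCycle.setoid M.φ) d

/-- The degree of a vertex; a loop counts twice. -/
noncomputable def vertexDegree (v : M.Vertex) : ℕ := {d : D | M.origin d = v}.ncard

/-- The degree of a face; an edge with the face on both sides counts twice. -/
noncomputable def faceDegree (f : M.Face) : ℕ := {d : D | M.rightFace d = f}.ncard

/-- The simple graph of adjacency between distinct vertices of the map. -/
def graph : SimpleGraph M.Vertex where
  Adj u v := u ≠ v ∧ ∃ d, M.origin d = u ∧ M.target d = v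
  symm := ⟨by
    rintro u v ⟨huv, d, hu, hv⟩
    refine ⟨huv.symm, M.α d, hv, ?_⟩
    rw [target, M.α_α, hu]⟩
  loopless := ⟨fun _ h => h.1 rfl⟩

/-- The underlying graph is connected and the surface is the sphere (Euler's formula). -/
structure IsPlanar : Prop where
  connected : M.graph.Connected
  euler : Nat.card M.Vertex + Nat.card M.Face = Nat.card M.Edge + 2

/-- No loops, and the deletion of any vertex does not disconnect the map. -/
structure IsNonSeparable : Prop where
  loopless : ∀ d, M.origin d ≠ M.target d
  two_connected : ∀ v : M.Vertex, (M.graph.induce {v}ᶜ).Preconnected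

/-- All faces, the root-face included, have degree 3. -/
def IsTriangulation : Prop := ∀ f : M.Face, M.faceDegree f = 3

/-- A vertex is incident to the root if it is the origin or the end of the root. -/
def IncidentToRoot (v : M.Vertex) : Prop := v = M.origin M.root ∨ v = M.target M.root

/-- Non-separable planar triangulations. -/
structure IsNonSepTriangulation : Prop where
  planar : M.IsPlanar
  nonSeparable : M.IsNonSeparable
  triangulation : M.IsTriangulation

/-- Two rooted maps are the same map if a relabelling of the darts carries one to the other. -/
def Iso (N : RootedCombMap D) : Prop :=
  ∃ e : D ≃ D, (∀ d, e (M.σ d) = N.σ (e d)) ∧ (∀ d, e (M.α d) = N.α (e d)) ∧ e M.root = N.root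

/-- Sameness of rooted maps is an equivalence relation. -/
def isoSetoid (D : Type) : Setoid (RootedCombMap D) where
  r := Iso
  iseqv :=
    { refl := fun _ => ⟨Equiv.refl _, fun _ => rfl, fun _ => rfl, rfl⟩
      symm := by
        rintro M N ⟨e, hσ, hα, hr⟩
        refine ⟨e.symm, fun d => ?_, fun d => ?_, ?_⟩
        · rw [Equiv.symm_apply_eq, hσ, Equiv.apply_symm_apply]
        · rw [Equiv.symm_apply_eq, hα, Equiv.apply_symm_apply]
        · rw [Equiv.symm_apply_eq, hr]
      trans := by
        rintro M N P ⟨e, hσ, hα, hr⟩ ⟨e', hσ', hα', hr'⟩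
        refine ⟨e.trans e', fun d => ?_, fun d => ?_, ?_⟩
        · simp [hσ, hσ']
        · simp [hα, hα']
        · simp [hr, hr'] }

end RootedCombMap

/-- Rooted combinatorial maps with `m` edges (`2 * m` darts), up to relabelling of the darts. -/
def RootedMapClass (m : ℕ) : Type := Quotient (RootedCombMap.isoSetoid (Fin (2 * m)))

/-- The rooted map (up to relabelling) given by a labelled rooted map. -/
def RootedMapClass.mk {m : ℕ} (M : RootedCombMap (Fin (2 * m))) : RootedMapClass m :=
  Quotient.mk (RootedCombMap.isoSetoid (Fin (2 * m))) M

/-- Non-separable rooted triangulations with `m` edges in which every vertex not incident to the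
root has degree at least 3. -/
def triangulationsG (m : ℕ) : Set (RootedMapClass m) :=
  RootedMapClass.mk '' {M | M.IsNonSepTriangulation ∧
    ∀ v : M.Vertex, ¬ M.IncidentToRoot v → 3 ≤ M.vertexDegree v}

/-- Non-separable rooted triangulations with `m` edges in which every vertex has degree at
least 3. -/
def triangulationsGStar (m : ℕ) : Set (RootedMapClass m) :=
  RootedMapClass.mk '' {M | M.IsNonSepTriangulation ∧ ∀ v : M.Vertex, 3 ≤ M.vertexDegree v}

/-- The generating function of a family of maps: the coefficient of `t ^ n` is the number of
maps of the family with `3 * n` edges. -/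
noncomputable def triangulationGF (L : (m : ℕ) → Set (RootedMapClass m)) : PowerSeries ℤ :=
  PowerSeries.mk fun n => ((L (3 * n)).ncard : ℤ)

/-!
Let `v` be a vertex of degree 2 in a non-separable triangulation, with neighbours `u` and `w`. The
two faces at `v` are triangles `u v w`, so their sides opposite to `v` are two edges joining `u` and
`w`. A triangulation of `𝐆` with `3 (n + 1)` edges that is not in `𝐆*` has such a vertex `v`
at one end of its root; suppose that `v` is the origin of the root and `u` its end. The two edges
between `u` and `w` are distinct, since otherwise `w`, which is not incident to the root, would have
degree 2. Deleting `v` and merging the two edges into the new root gives a triangulation of `𝐆` with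
three edges fewer. Conversely, doubling the root edge of any member of `𝐆` and putting a vertex of
degree 2 between the two copies gives a member of `𝐆` whose root starts at a vertex of degree 2
(`RootedCombMap.insertRoot`, `RootedCombMap.IsTypeG.exists_isIso_insertRoot`). The operation is
injective on isomorphism classes because the new root determines the inserted darts. The case where
the root ends at the vertex of degree 2 is the mirror case under reversal of the root, and the two
cases exclude each other because both ends of the old root edge gain two edges. Hence
`|𝐆ₙ₊₁| = |𝐆*ₙ₊₁| + 2 |𝐆ₙ|` (`ncard_triangulationsG_add_three`).

In terms of darts, with a map described by its face permutation and the reversal, the insertion is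
the disjoint union with a triangle followed by the conjugation of the reversal by a transposition of
two darts. The insertion and its inverse therefore leave the faces of the old map alone. Euler's
formula reduces to a relation between the numbers of vertices and darts
(`RootedCombMap.isNonSepTriangulation_iff`), and non-separability is preserved in both directions
because the neighbours of the new vertex are adjacent (`SimpleGraph.noCutVertex_option_iff`).
-/

/-! ### Cycles of permutations -/

section Cycles

variable {D D' : Type}

/-- The type of cycles of a permutation, fixed points included. -/
abbrev Equiv.Perm.CycleQuotient (π : Equiv.Perm D) : Type :=
  Quotient (Equiv.Perm.SameCycle.setoid π)

theorem Equiv.Perm.SameCycle.eq_of_invariant {X : Type} {π : Equiv.Perm D} {f : D → X}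
    (hf : ∀ d, f (π d) = f d) {a b : D} (h : π.SameCycle a b) : f a = f b := by
  obtain ⟨i, rfl⟩ := h
  induction i using Int.induction_on generalizing a with
  | zero => rfl
  | succ n ih => rw [zpow_add_one, Equiv.Perm.mul_apply, ← ih, hf]
  | pred n ih =>
    rw [zpow_sub_one, Equiv.Perm.mul_apply, ← ih, ← hf (π⁻¹ a)]
    exact congrArg f (π.apply_symm_apply a).symm

theorem Equiv.Perm.SameCycle.map_equiv {π : Equiv.Perm D} {π' : Equiv.Perm D'} (e : D ≃ D')
    (he : ∀ d, e (π d) = π' (e d)) {a b : D} (h : π.SameCycle a b) :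
    π'.SameCycle (e a) (e b) := by
  refine Quotient.exact (s := Equiv.Perm.SameCycle.setoid π') ?_
  refine h.eq_of_invariant (f := fun d => (Quotient.mk _ (e d) : π'.CycleQuotient)) fun d => ?_
  refine Quotient.sound (s := Equiv.Perm.SameCycle.setoid π') ?_
  rw [he]
  exact Equiv.Perm.sameCycle_apply_left.2 (Equiv.Perm.SameCycle.refl _ _)

/-- The equivalence between the cycles of two conjugate permutations. -/
def Equiv.Perm.cycleQuotientCongr {π : Equiv.Perm D} {π' : Equiv.Perm D'} (e : D ≃ D')
    (he : ∀ d, e (π d) = π' (e d)) : π.CycleQuotient ≃ π'.CycleQuotient :=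
  Quotient.congr e fun a b => by
    refine ⟨fun h => Equiv.Perm.SameCycle.map_equiv e he h, fun h => ?_⟩
    have h' : π.SameCycle (e.symm (e a)) (e.symm (e b)) :=
      Equiv.Perm.SameCycle.map_equiv (π := π') (π' := π) e.symm (fun d => by
        rw [Equiv.symm_apply_eq, he, Equiv.apply_symm_apply]) h
    rwa [Equiv.symm_apply_apply, Equiv.symm_apply_apply] at h'

theorem Equiv.Perm.ncard_cycle_eq_minimalPeriod [Finite D] (π : Equiv.Perm D) (d : D) :
    {x : D | (Quotient.mk _ x : π.CycleQuotient) = Quotient.mk _ d}.ncard =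
      Function.minimalPeriod π d := by
  classical
  have := Fintype.ofFinite D
  have h := MulAction.minimalPeriod_eq_card (a := π) (b := d)
  have h2 : {x : D | (Quotient.mk _ x : π.CycleQuotient) = Quotient.mk _ d} =
      MulAction.orbit (Subgroup.zpowers π) d := by
    ext x
    rw [Set.mem_ofPred_eq, Quotient.eq (r := Equiv.Perm.SameCycle.setoid π)]
    change π.SameCycle x d ↔ _
    rw [Equiv.Perm.sameCycle_comm]
    constructor
    · rintro ⟨i, hi⟩
      exact ⟨⟨π ^ i, i, rfl⟩, hi⟩
    · rintro ⟨⟨_, i, rfl⟩, hi⟩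
      exact ⟨i, hi⟩
  rw [h2, ← Nat.card_coe_set_eq, Nat.card_eq_fintype_card, ← h]
  rfl

theorem Equiv.Perm.ncard_cycle_eq_prime_iff [Finite D] (π : Equiv.Perm D) (d : D) {p : ℕ}
    (hp : p.Prime) :
    {x : D | (Quotient.mk _ x : π.CycleQuotient) = Quotient.mk _ d}.ncard = p ↔
      π^[p] d = d ∧ π d ≠ d := by
  have : Fact p.Prime := ⟨hp⟩
  rw [π.ncard_cycle_eq_minimalPeriod, Function.minimalPeriod_eq_prime_iff]
  rfl

/-- If all cycles have the same prime length, their number is determined by the number of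
points. -/
theorem Equiv.Perm.card_eq_prime_mul_card_cycleQuotient [Finite D] (π : Equiv.Perm D) {p : ℕ}
    (hp : p.Prime) (h : ∀ d, π^[p] d = d ∧ π d ≠ d) :
    Nat.card D = p * Nat.card π.CycleQuotient := by
  classical
  have := Fintype.ofFinite D
  have := Fintype.ofFinite π.CycleQuotient
  rw [Nat.card_congr (Equiv.sigmaFiberEquiv
    (fun d => (Quotient.mk _ d : π.CycleQuotient))).symm, Nat.card_sigma]
  rw [Finset.sum_congr rfl (g := fun _ => p), Finset.sum_const, Finset.card_univ, smul_eq_mul,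
    mul_comm, Nat.card_eq_fintype_card]
  intro q _
  induction q using Quotient.inductionOn with
  | h d => exact (π.ncard_cycle_eq_prime_iff d hp).2 (h d)

end Cycles

/-! ### Graphs without cut vertex -/

namespace SimpleGraph

variable {V W : Type} {G : SimpleGraph V} {H : SimpleGraph W}

/-- Connected, and not disconnected by the deletion of a vertex. -/
def NoCutVertex (G : SimpleGraph V) : Prop :=
  G.Connected ∧ ∀ v, (G.induce {v}ᶜ).Preconnected

theorem Reachable.of_adj_reachable (f : V → W)
    (h : ∀ x y, G.Adj x y → H.Reachable (f x) (f y)) {x y : V} (hxy : G.Reachable x y) :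
    H.Reachable (f x) (f y) := by
  obtain ⟨p⟩ := hxy
  induction p with
  | nil => exact Reachable.refl _
  | cons hadj _ ih => exact (h _ _ hadj).trans ih

theorem Preconnected.of_surjective (hG : G.Preconnected) (f : V → W)
    (hf : Function.Surjective f) (h : ∀ x y, G.Adj x y → H.Reachable (f x) (f y)) :
    H.Preconnected := by
  intro a b
  obtain ⟨x, rfl⟩ := hf a
  obtain ⟨y, rfl⟩ := hf b
  exact (hG x y).of_adj_reachable f h

theorem NoCutVertex.of_iso (h : G.NoCutVertex) (e : G ≃g H) : H.NoCutVertex := by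
  refine ⟨e.connected_iff.1 h.1, fun v => ?_⟩
  refine (h.2 (e.symm v)).of_surjective
    (fun x => ⟨e x.1, fun hx => x.2 (by
      exact e.injective ((Set.mem_singleton_iff.1 hx).trans (e.apply_symm_apply v).symm))⟩) ?_ ?_
  · rintro ⟨y, hy⟩
    refine ⟨⟨e.symm y, fun hx => hy (e.symm.injective hx)⟩, Subtype.ext (e.apply_symm_apply y)⟩
  · intro x y hxy
    exact SimpleGraph.Adj.reachable (e.map_adj_iff.2 hxy)

/-- Adding a vertex whose two neighbours are already adjacent neither creates nor destroys cut
vertices: contracting the new vertex onto either neighbour is a retraction. -/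
theorem noCutVertex_option_iff {G : SimpleGraph (Option W)} {a b : W}
    (hsome : ∀ x y, G.Adj (some x) (some y) ↔ H.Adj x y)
    (hnone : ∀ x, G.Adj none (some x) ↔ x = a ∨ x = b) (hab : H.Adj a b) :
    G.NoCutVertex ↔ H.NoCutVertex := by
  have hchoice : ∀ x : W, ∃ c, c ≠ x ∧ (c = a ∨ c = b) := by
    intro x
    by_cases hx : a = x
    · exact ⟨b, fun h => hab.ne (hx.trans h.symm), Or.inr rfl⟩
    · exact ⟨a, hx, Or.inl rfl⟩
  constructor
  · intro hG
    refine ⟨(connected_iff _).2 ⟨?_, ⟨a⟩⟩, fun x => ?_⟩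
    · refine (hG.2 none).of_surjective
        (fun x => x.1.get (Option.ne_none_iff_isSome.1 x.2)) ?_ ?_
      · intro x
        exact ⟨⟨some x, Option.some_ne_none x⟩, rfl⟩
      · rintro ⟨_ | x, hx⟩ ⟨_ | y, hy⟩ hxy
        · exact absurd rfl hx
        · exact absurd rfl hx
        · exact absurd rfl hy
        · exact Adj.reachable ((hsome x y).1 hxy)
    · obtain ⟨c, hcx, hc⟩ := hchoice x
      have hreach : ∀ y (hy : y ≠ x), (y = a ∨ y = b) →
          (H.induce {x}ᶜ).Reachable ⟨c, hcx⟩ ⟨y, hy⟩ := by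
        intro y hy hyab
        by_cases hcy : c = y
        · subst hcy
          exact Reachable.refl _
        · refine Adj.reachable ?_
          change H.Adj c y
          rcases hc with rfl | rfl <;> rcases hyab with rfl | rfl
          · exact absurd rfl hcy
          · exact hab
          · exact hab.symm
          · exact absurd rfl hcy
      refine (hG.2 (some x)).of_surjective
        (fun y => ⟨y.1.getD c, ?_⟩) ?_ ?_
      · obtain ⟨_ | y, hy⟩ := y
        · exact hcx
        · exact fun h => hy (congrArg some h)
      · rintro ⟨y, hy⟩
        exact ⟨⟨some y, fun h => hy (Option.some_injective _ h)⟩, rfl⟩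
      · rintro ⟨_ | y, hy⟩ ⟨_ | z, hz⟩ hyz
        · exact Reachable.refl _
        · exact hreach z _ ((hnone z).1 hyz)
        · exact (hreach y _ ((hnone y).1 (G.adj_symm hyz))).symm
        · exact Adj.reachable (G := H.induce {x}ᶜ) ((hsome y z).1 hyz)
  · intro hH
    refine ⟨(connected_iff _).2 ⟨?_, ⟨none⟩⟩, fun x => ?_⟩
    · have hbase : ∀ z, G.Reachable z (some a) := by
        rintro (_ | z)
        · exact Adj.reachable ((hnone a).2 (Or.inl rfl))
        · exact (hH.1.preconnected z a).of_adj_reachable some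
            fun y z hyz => Adj.reachable ((hsome y z).2 hyz)
      exact fun y z => (hbase y).trans (hbase z).symm
    · rcases x with _ | x
      · refine hH.1.preconnected.of_surjective
          (fun y => ⟨some y, Option.some_ne_none y⟩) ?_ ?_
        · rintro ⟨_ | y, hy⟩
          · exact absurd rfl hy
          · exact ⟨y, rfl⟩
        · intro y z hyz
          exact Adj.reachable (G := G.induce {none}ᶜ) ((hsome y z).2 hyz)
      · obtain ⟨c, hcx, hc⟩ := hchoice x
        have hbase : ∀ z, (G.induce {some x}ᶜ).Reachable z
            ⟨some c, fun h => hcx (Option.some_injective _ h)⟩ := by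
          rintro ⟨_ | z, hz⟩
          · exact Adj.reachable (G := G.induce {some x}ᶜ) ((hnone c).2 hc)
          · refine Reachable.of_adj_reachable (H := G.induce {some x}ᶜ)
              (fun y : ({x}ᶜ : Set W) => ⟨some y.1, fun h => y.2 (Option.some_injective _ h)⟩)
              (fun y z hyz => Adj.reachable ?_)
              (hH.2 x ⟨z, fun h => hz (congrArg some h)⟩ ⟨c, hcx⟩)
            exact (hsome y.1 z.1).2 hyz
        exact fun y z => (hbase y).trans (hbase z).symm

end SimpleGraph

/-! ### Rooted maps in terms of darts -/

namespace RootedCombMap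

section Darts

variable {D : Type} (M : RootedCombMap D)

theorem origin_eq_origin_iff {d d' : D} : M.origin d = M.origin d' ↔ M.σ.SameCycle d d' :=
  Quotient.eq (r := Equiv.Perm.SameCycle.setoid M.σ)

theorem origin_σ (d : D) : M.origin (M.σ d) = M.origin d :=
  (M.origin_eq_origin_iff).2 (Equiv.Perm.sameCycle_apply_left.2 (Equiv.Perm.SameCycle.refl _ _))

theorem origin_surjective : Function.Surjective M.origin := Quotient.mk_surjective

theorem origin_φ (d : D) : M.origin (M.φ d) = M.target d := M.origin_σ (M.α d)

theorem φ_α (d : D) : M.φ (M.α d) = M.σ d := by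
  rw [φ, Equiv.Perm.mul_apply, M.α_α]

theorem isTriangulation_iff [Finite D] :
    M.IsTriangulation ↔ ∀ d, M.φ (M.φ (M.φ d)) = d ∧ M.φ d ≠ d := by
  constructor
  · intro h d
    exact (M.φ.ncard_cycle_eq_prime_iff d Nat.prime_three).1 (h (M.rightFace d))
  · intro h f
    induction f using Quotient.inductionOn with
    | h d => exact (M.φ.ncard_cycle_eq_prime_iff d Nat.prime_three).2 (h d)

/-- Non-separable planar triangulations with the faces and edges counted out: Euler's formula then
relates the number of vertices to the number of darts. -/
theorem isNonSepTriangulation_iff [Finite D] :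
    M.IsNonSepTriangulation ↔ M.graph.NoCutVertex ∧ 6 * Nat.card M.Vertex = Nat.card D + 12 ∧
      (∀ d, M.origin d ≠ M.target d) ∧ ∀ d, M.φ (M.φ (M.φ d)) = d ∧ M.φ d ≠ d := by
  have hE : Nat.card D = 2 * Nat.card M.Edge :=
    M.α.card_eq_prime_mul_card_cycleQuotient Nat.prime_two fun d => ⟨M.α_α d, M.α_ne d⟩
  have hF : (∀ d, M.φ (M.φ (M.φ d)) = d ∧ M.φ d ≠ d) → Nat.card D = 3 * Nat.card M.Face :=
    M.φ.card_eq_prime_mul_card_cycleQuotient Nat.prime_three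
  constructor
  · rintro ⟨⟨hconn, heuler⟩, ⟨hloop, hcut⟩, htri⟩
    have htri' := M.isTriangulation_iff.1 htri
    have := hF htri'
    exact ⟨⟨hconn, hcut⟩, by omega, hloop, htri'⟩
  · rintro ⟨⟨hconn, hcut⟩, heuler, hloop, htri⟩
    have := hF htri
    exact ⟨⟨hconn, by omega⟩, ⟨hloop, hcut⟩, M.isTriangulation_iff.2 htri⟩

/-- A vertex of a non-separable triangulation of degree less than 3 has degree 2. -/
theorem IsNonSepTriangulation.σ_σ_eq [Finite D] {M : RootedCombMap D}
    (h : M.IsNonSepTriangulation) {d : D} (hd : M.vertexDegree (M.origin d) < 3) :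
    M.σ (M.σ d) = d ∧ M.σ d ≠ d := by
  obtain ⟨-, -, hloop, htri⟩ := M.isNonSepTriangulation_iff.1 h
  have hne : M.σ d ≠ d := by
    intro hfix
    -- a dart fixed by `σ` comes back to its own reversal, and closes up a loop
    have h1 : M.φ (M.α d) = d := by rw [M.φ_α, hfix]
    have h2 := (htri (M.α d)).1
    rw [h1] at h2
    apply hloop (M.φ d)
    rw [← M.origin_φ, h2, M.origin_φ]
    rfl
  refine ⟨?_, hne⟩
  by_contra hne2
  apply absurd hd
  rw [not_lt, Nat.succ_le_iff, vertexDegree, Set.two_lt_ncard_iff]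
  refine ⟨d, M.σ d, M.σ (M.σ d), rfl, M.origin_σ d, ?_, hne.symm, fun h => hne2 h.symm,
    fun h => hne (M.σ.injective h.symm)⟩
  exact (M.origin_σ _).trans (M.origin_σ d)

end Darts

/-! ### Isomorphisms of rooted maps -/

section Isomorphism

variable {D D' D'' : Type}

/-- `e` carries the rooted map `M` to the rooted map `N`. -/
structure IsIso (e : D ≃ D') (M : RootedCombMap D) (N : RootedCombMap D') : Prop where
  map_σ : ∀ d, e (M.σ d) = N.σ (e d)
  map_α : ∀ d, e (M.α d) = N.α (e d)
  map_root : e M.root = N.root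

/-- The rooted map obtained by relabelling the darts. -/
def relabel (e : D ≃ D') (M : RootedCombMap D) : RootedCombMap D' where
  σ := e.permCongr M.σ
  α := e.permCongr M.α
  α_α d := by simp [Equiv.permCongr_apply, M.α_α]
  α_ne d := by
    rw [Equiv.permCongr_apply, Ne, ← Equiv.eq_symm_apply]
    exact M.α_ne _
  root := e M.root

theorem isIso_relabel (e : D ≃ D') (M : RootedCombMap D) : IsIso e M (M.relabel e) where
  map_σ d := by simp [relabel, Equiv.permCongr_apply]
  map_α d := by simp [relabel, Equiv.permCongr_apply]
  map_root := rfl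

namespace IsIso

variable {e : D ≃ D'} {M : RootedCombMap D} {N : RootedCombMap D'}

theorem symm (h : IsIso e M N) : IsIso e.symm N M where
  map_σ d := by rw [Equiv.symm_apply_eq, h.map_σ, Equiv.apply_symm_apply]
  map_α d := by rw [Equiv.symm_apply_eq, h.map_α, Equiv.apply_symm_apply]
  map_root := by rw [Equiv.symm_apply_eq, h.map_root]

theorem trans {e' : D' ≃ D''} {P : RootedCombMap D''} (h : IsIso e M N) (h' : IsIso e' N P) :
    IsIso (e.trans e') M P where
  map_σ d := by simp [h.map_σ, h'.map_σ]
  map_α d := by simp [h.map_α, h'.map_α]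
  map_root := by simp [h.map_root, h'.map_root]

theorem map_φ (h : IsIso e M N) (d : D) : e (M.φ d) = N.φ (e d) := by
  rw [φ, φ, Equiv.Perm.mul_apply, Equiv.Perm.mul_apply, h.map_σ, h.map_α]

/-- The bijection between the vertices of isomorphic maps. -/
def vertexEquiv (h : IsIso e M N) : M.Vertex ≃ N.Vertex :=
  Equiv.Perm.cycleQuotientCongr e h.map_σ

theorem vertexEquiv_origin (h : IsIso e M N) (d : D) :
    h.vertexEquiv (M.origin d) = N.origin (e d) := rfl

theorem vertexEquiv_target (h : IsIso e M N) (d : D) :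
    h.vertexEquiv (M.target d) = N.target (e d) := by
  rw [target, target, vertexEquiv_origin, h.map_α]

/-- The isomorphism between the adjacency graphs of isomorphic maps. -/
def graphIso (h : IsIso e M N) : M.graph ≃g N.graph where
  toEquiv := h.vertexEquiv
  map_rel_iff' {u v} := by
    change (_ ≠ _ ∧ _) ↔ (_ ≠ _ ∧ _)
    refine and_congr (h.vertexEquiv.injective.ne_iff) ?_
    rw [e.symm.exists_congr_left]
    refine exists_congr fun d => ?_
    rw [Equiv.symm_symm, ← h.vertexEquiv_origin, ← h.vertexEquiv_target,
      h.vertexEquiv.injective.eq_iff, h.vertexEquiv.injective.eq_iff]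

theorem vertexDegree_eq (h : IsIso e M N) (v : M.Vertex) :
    N.vertexDegree (h.vertexEquiv v) = M.vertexDegree v := by
  rw [vertexDegree, vertexDegree, ← Set.ncard_image_of_injective _ e.injective]
  congr 1
  ext d
  obtain ⟨d, rfl⟩ := e.surjective d
  rw [e.injective.mem_set_image, Set.mem_ofPred_eq, Set.mem_ofPred_eq, ← h.vertexEquiv_origin,
    h.vertexEquiv.injective.eq_iff]

theorem incidentToRoot_iff (h : IsIso e M N) (v : M.Vertex) :
    N.IncidentToRoot (h.vertexEquiv v) ↔ M.IncidentToRoot v := by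
  rw [IncidentToRoot, IncidentToRoot, ← h.map_root, ← h.vertexEquiv_origin,
    ← h.vertexEquiv_target, h.vertexEquiv.injective.eq_iff, h.vertexEquiv.injective.eq_iff]

theorem isNonSepTriangulation [Finite D] (h : IsIso e M N) (hM : M.IsNonSepTriangulation) :
    N.IsNonSepTriangulation := by
  have := Finite.of_equiv D e
  rw [isNonSepTriangulation_iff] at hM ⊢
  obtain ⟨hcut, hcard, hloop, htri⟩ := hM
  refine ⟨hcut.of_iso h.graphIso, ?_, fun d => ?_, fun d => ?_⟩
  · rw [← Nat.card_congr e, ← Nat.card_congr h.vertexEquiv, hcard]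
  · obtain ⟨d, rfl⟩ := e.surjective d
    rw [← h.vertexEquiv_origin, ← h.vertexEquiv_target]
    exact h.vertexEquiv.injective.ne (hloop d)
  · obtain ⟨d, rfl⟩ := e.surjective d
    rw [← h.map_φ, ← h.map_φ, ← h.map_φ]
    exact ⟨congrArg e (htri d).1, e.injective.ne (htri d).2⟩

end IsIso

end Isomorphism

end RootedCombMap

/-! ### Doubling the root edge around a new vertex of degree 2 -/

/-- The six darts of a single triangle with corners `u`, `v`, `w` on the sphere, each named by its
origin and its end. -/
inductive TriangleDart
  | uv | vw | wu | vu | wv | uw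
  deriving DecidableEq

namespace TriangleDart

instance : Fintype TriangleDart where
  elems := {uv, vw, wu, vu, wv, uw}
  complete := by rintro ⟨⟩ <;> decide

/-- Each of the two sides of the triangle is a face. -/
def rotate : Equiv.Perm TriangleDart where
  toFun
    | uv => vw | vw => wu | wu => uv
    | wv => vu | vu => uw | uw => wv
  invFun
    | vw => uv | wu => vw | uv => wu
    | vu => wv | uw => vu | wv => uw
  left_inv := by rintro ⟨⟩ <;> rfl
  right_inv := by rintro ⟨⟩ <;> rfl

/-- Reversal of the darts of the triangle. -/
def reverse : Equiv.Perm TriangleDart where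
  toFun
    | uv => vu | vw => wv | wu => uw
    | vu => uv | wv => vw | uw => wu
  invFun
    | uv => vu | vw => wv | wu => uw
    | vu => uv | wv => vw | uw => wu
  left_inv := by rintro ⟨⟩ <;> rfl
  right_inv := by rintro ⟨⟩ <;> rfl

theorem reverse_reverse (t : TriangleDart) : reverse (reverse t) = t := by
  cases t <;> rfl

theorem reverse_ne (t : TriangleDart) : reverse t ≠ t := by
  cases t <;> decide

end TriangleDart

namespace RootedCombMap

open TriangleDart

open scoped Classical in
/-- The map in which the root edge, running from `w` to `u`, is doubled and a vertex `v` of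
degree 2 adjacent to `u` and `w` is put between the two copies; the new root runs from `v` to `u`.

Equivalently, the map and a triangle `u`, `v`, `w` are cut open along the root edge and along the
edge `wu`, and glued to each other: the faces are those of the two pieces, and the reversal of darts
is conjugated by the transposition of the root and the dart `wu`. -/
noncomputable def insertRoot {D : Type} (M : RootedCombMap D) :
    RootedCombMap (D ⊕ TriangleDart) :=
  let α' : Equiv.Perm (D ⊕ TriangleDart) :=
    Equiv.swap (Sum.inr wu) (Sum.inl M.root) * Equiv.sumCongr M.α reverse *
      Equiv.swap (Sum.inr wu) (Sum.inl M.root)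
  { σ := Equiv.sumCongr M.φ rotate * α'
    α := α'
    α_α := by
      rintro d
      simp only [α', Equiv.Perm.mul_apply, Equiv.swap_apply_self]
      generalize hx : Equiv.swap (Sum.inr wu) (Sum.inl M.root) d = x
      have : Equiv.sumCongr M.α reverse (Equiv.sumCongr M.α reverse x) = x := by
        rcases x with x | t
        · exact congrArg Sum.inl (M.α_α x)
        · exact congrArg Sum.inr (reverse_reverse t)
      rw [this, ← hx, Equiv.swap_apply_self]
    α_ne := by
      intro d
      simp only [α', Equiv.Perm.mul_apply]
      rw [Ne, ← Equiv.eq_symm_apply, Equiv.symm_swap]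
      generalize Equiv.swap (Sum.inr wu) (Sum.inl M.root) d = x
      rcases x with x | t
      · exact fun h => M.α_ne x (Sum.inl_injective h)
      · exact fun h => reverse_ne t (Sum.inr_injective h)
    root := Sum.inr vu }

section InsertRoot

variable {D : Type} (M : RootedCombMap D)

theorem insertRoot_root : M.insertRoot.root = Sum.inr vu := rfl

theorem insertRoot_φ : M.insertRoot.φ = Equiv.sumCongr M.φ rotate := by
  ext d
  change Equiv.sumCongr M.φ rotate (M.insertRoot.α (M.insertRoot.α d)) = _
  rw [M.insertRoot.α_α]

theorem insertRoot_φ_inl (d : D) : M.insertRoot.φ (Sum.inl d) = Sum.inl (M.φ d) := by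
  rw [insertRoot_φ]; rfl

theorem insertRoot_φ_inr (t : TriangleDart) :
    M.insertRoot.φ (Sum.inr t) = Sum.inr (rotate t) := by
  rw [insertRoot_φ]; rfl

open scoped Classical in
theorem insertRoot_α_apply (d : D ⊕ TriangleDart) :
    M.insertRoot.α d = Equiv.swap (Sum.inr wu) (Sum.inl M.root)
      (Equiv.sumCongr M.α reverse (Equiv.swap (Sum.inr wu) (Sum.inl M.root) d)) := rfl

theorem insertRoot_α_root : M.insertRoot.α (Sum.inl M.root) = Sum.inr uw := by
  classical
  rw [insertRoot_α_apply, Equiv.swap_apply_right]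
  exact Equiv.swap_apply_of_ne_of_ne (by simp [reverse]) (by simp)

theorem insertRoot_α_uw : M.insertRoot.α (Sum.inr uw) = Sum.inl M.root := by
  rw [← insertRoot_α_root, M.insertRoot.α_α]

theorem insertRoot_α_wu : M.insertRoot.α (Sum.inr wu) = Sum.inl (M.α M.root) := by
  classical
  rw [insertRoot_α_apply, Equiv.swap_apply_left]
  exact Equiv.swap_apply_of_ne_of_ne (by simp) (by simpa using M.α_ne _)

theorem insertRoot_α_α_root : M.insertRoot.α (Sum.inl (M.α M.root)) = Sum.inr wu := by
  rw [← insertRoot_α_wu, M.insertRoot.α_α]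

theorem insertRoot_α_inl {d : D} (h1 : d ≠ M.root) (h2 : d ≠ M.α M.root) :
    M.insertRoot.α (Sum.inl d) = Sum.inl (M.α d) := by
  classical
  have h3 : M.α d ≠ M.root := fun h => h2 (by rw [← h, M.α_α])
  have h4 : Equiv.swap (Sum.inr wu) (Sum.inl M.root) (Sum.inl d) = Sum.inl d :=
    Equiv.swap_apply_of_ne_of_ne (by simp) (by simpa using h1)
  rw [insertRoot_α_apply, h4]
  exact Equiv.swap_apply_of_ne_of_ne (by simp) (by simpa using h3)

theorem insertRoot_α_inr {t : TriangleDart} (h1 : t ≠ wu) (h2 : t ≠ uw) :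
    M.insertRoot.α (Sum.inr t) = Sum.inr (reverse t) := by
  classical
  have h3 : reverse t ≠ wu := fun h => h2 (by rw [← reverse_reverse t, h]; rfl)
  have h4 : Equiv.swap (Sum.inr wu) (Sum.inl M.root) (Sum.inr t) = Sum.inr t :=
    Equiv.swap_apply_of_ne_of_ne (by simpa using h1) (by simp)
  rw [insertRoot_α_apply, h4]
  exact Equiv.swap_apply_of_ne_of_ne (by simpa using h3) (by simp)

theorem insertRoot_σ_inl {d : D} (h1 : d ≠ M.root) (h2 : d ≠ M.α M.root) :
    M.insertRoot.σ (Sum.inl d) = Sum.inl (M.σ d) := by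
  rw [← φ_α, M.insertRoot_α_inl h1 h2, insertRoot_φ_inl, φ_α]

theorem insertRoot_σ_root : M.insertRoot.σ (Sum.inl M.root) = Sum.inr wv := by
  rw [← φ_α, insertRoot_α_root, insertRoot_φ_inr]; rfl

theorem insertRoot_σ_α_root : M.insertRoot.σ (Sum.inl (M.α M.root)) = Sum.inr uv := by
  rw [← φ_α, insertRoot_α_α_root, insertRoot_φ_inr]; rfl

theorem insertRoot_σ_wu : M.insertRoot.σ (Sum.inr wu) = Sum.inl (M.σ M.root) := by
  rw [← φ_α, insertRoot_α_wu, insertRoot_φ_inl, φ_α]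

theorem insertRoot_σ_uw : M.insertRoot.σ (Sum.inr uw) = Sum.inl (M.σ (M.α M.root)) := by
  rw [← φ_α, insertRoot_α_uw, insertRoot_φ_inl]; rfl

theorem insertRoot_σ_inr {t : TriangleDart} (h1 : t ≠ wu) (h2 : t ≠ uw) :
    M.insertRoot.σ (Sum.inr t) = Sum.inr (rotate (reverse t)) := by
  rw [← φ_α, M.insertRoot_α_inr h1 h2, insertRoot_φ_inr]

/-- The origin of a dart after the insertion, `none` standing for the new vertex. -/
def insertRootOrigin : D ⊕ TriangleDart → Option M.Vertex
  | Sum.inl d => some (M.origin d)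
  | Sum.inr wv => some (M.origin M.root)
  | Sum.inr wu => some (M.origin M.root)
  | Sum.inr uv => some (M.target M.root)
  | Sum.inr uw => some (M.target M.root)
  | Sum.inr vw => none
  | Sum.inr vu => none

theorem insertRootOrigin_σ (d : D ⊕ TriangleDart) :
    M.insertRootOrigin (M.insertRoot.σ d) = M.insertRootOrigin d := by
  rcases d with d | t
  · by_cases h1 : d = M.root
    · rw [h1, insertRoot_σ_root]; rfl
    by_cases h2 : d = M.α M.root
    · rw [h2, insertRoot_σ_α_root]; rfl
    rw [M.insertRoot_σ_inl h1 h2]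
    exact congrArg some (M.origin_σ d)
  · cases t with
    | wu => rw [insertRoot_σ_wu]; exact congrArg some (M.origin_σ _)
    | uw => rw [insertRoot_σ_uw]; exact congrArg some (M.origin_σ _)
    | _ => rw [M.insertRoot_σ_inr (by decide) (by decide)]; rfl

theorem insertRoot_origin_wv :
    M.insertRoot.origin (Sum.inr wv) = M.insertRoot.origin (Sum.inl M.root) := by
  rw [← insertRoot_σ_root, origin_σ]

theorem insertRoot_origin_uv :
    M.insertRoot.origin (Sum.inr uv) = M.insertRoot.origin (Sum.inl (M.α M.root)) := by
  rw [← insertRoot_σ_α_root, origin_σ]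

theorem insertRoot_origin_wu :
    M.insertRoot.origin (Sum.inr wu) = M.insertRoot.origin (Sum.inl M.root) := by
  rw [← insertRoot_origin_wv, ← origin_σ _ (Sum.inr wv), M.insertRoot_σ_inr] <;>
    first | rfl | decide

theorem insertRoot_origin_uw :
    M.insertRoot.origin (Sum.inr uw) = M.insertRoot.origin (Sum.inl (M.α M.root)) := by
  rw [← insertRoot_origin_uv, ← origin_σ _ (Sum.inr uv), M.insertRoot_σ_inr] <;>
    first | rfl | decide

theorem insertRoot_origin_vw :
    M.insertRoot.origin (Sum.inr vw) = M.insertRoot.origin (Sum.inr vu) := by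
  rw [← origin_σ _ (Sum.inr vu), M.insertRoot_σ_inr] <;> first | rfl | decide

theorem insertRoot_origin_inl_σ (d : D) :
    M.insertRoot.origin (Sum.inl (M.σ d)) = M.insertRoot.origin (Sum.inl d) := by
  by_cases h1 : d = M.root
  · rw [h1, ← insertRoot_origin_wu, ← insertRoot_σ_wu, origin_σ]
  by_cases h2 : d = M.α M.root
  · rw [h2, ← insertRoot_origin_uw, ← insertRoot_σ_uw, origin_σ]
  rw [← M.insertRoot_σ_inl h1 h2, origin_σ]

/-- The insertion adds one vertex to the vertices of the map. -/
noncomputable def insertRootVertexEquiv : M.insertRoot.Vertex ≃ Option M.Vertex where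
  toFun := Quotient.lift M.insertRootOrigin fun _ _ h =>
    Equiv.Perm.SameCycle.eq_of_invariant M.insertRootOrigin_σ h
  invFun
    | none => M.insertRoot.origin (Sum.inr vu)
    | some v => Quotient.lift (fun d => M.insertRoot.origin (Sum.inl d)) (fun _ _ h =>
        Equiv.Perm.SameCycle.eq_of_invariant (π := M.σ)
          (f := fun d => M.insertRoot.origin (Sum.inl d)) M.insertRoot_origin_inl_σ h) v
  left_inv v := by
    obtain ⟨d, rfl⟩ := M.insertRoot.origin_surjective v
    rcases d with d | t
    · rfl
    · cases t with
      | wv => exact M.insertRoot_origin_wv.symm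
      | wu => exact M.insertRoot_origin_wu.symm
      | uv => exact M.insertRoot_origin_uv.symm
      | uw => exact M.insertRoot_origin_uw.symm
      | vw => exact M.insertRoot_origin_vw.symm
      | vu => rfl
  right_inv v := by
    rcases v with _ | v
    · rfl
    · obtain ⟨d, rfl⟩ := M.origin_surjective v
      rfl

theorem insertRootVertexEquiv_symm_some (d : D) :
    M.insertRootVertexEquiv.symm (some (M.origin d)) = M.insertRoot.origin (Sum.inl d) := rfl

theorem insertRootOrigin_α_inl (d : D) :
    M.insertRootOrigin (M.insertRoot.α (Sum.inl d)) = some (M.target d) := by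
  by_cases h1 : d = M.root
  · rw [h1, insertRoot_α_root]; rfl
  by_cases h2 : d = M.α M.root
  · rw [h2, insertRoot_α_α_root, target, M.α_α]; rfl
  rw [M.insertRoot_α_inl h1 h2]; rfl

theorem insertRootOrigin_α_inr (t : TriangleDart) :
    M.insertRootOrigin (M.insertRoot.α (Sum.inr t)) =
      M.insertRootOrigin (Sum.inr (reverse t)) := by
  cases t with
  | wu => rw [insertRoot_α_wu]; rfl
  | uw => rw [insertRoot_α_uw]; rfl
  | _ => rw [M.insertRoot_α_inr (by decide) (by decide)]

theorem insertRoot_loopless_iff :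
    (∀ d, M.insertRoot.origin d ≠ M.insertRoot.target d) ↔ ∀ d, M.origin d ≠ M.target d := by
  have key : ∀ d, M.insertRoot.origin d ≠ M.insertRoot.target d ↔
      M.insertRootOrigin d ≠ M.insertRootOrigin (M.insertRoot.α d) := fun d =>
    M.insertRootVertexEquiv.injective.ne_iff.symm
  simp only [key]
  constructor
  · intro h d hd
    apply h (Sum.inl d)
    rw [insertRootOrigin_α_inl, ← hd]
    rfl
  · rintro h (d | t)
    · rw [insertRootOrigin_α_inl]
      exact fun h' => h d (Option.some_injective _ h')
    · rw [insertRootOrigin_α_inr]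
      cases t with
      | wu => exact fun h' => h _ (Option.some_injective _ h')
      | uw => exact fun h' => h _ (Option.some_injective _ h').symm
      | _ => exact fun h' => by cases h'

theorem insertRoot_noCutVertex_iff (hloop : M.origin M.root ≠ M.target M.root) :
    M.insertRoot.graph.NoCutVertex ↔ M.graph.NoCutVertex := by
  let e : M.insertRoot.Vertex ≃ Option M.Vertex := M.insertRootVertexEquiv
  let G : SimpleGraph (Option M.Vertex) := M.insertRoot.graph.comap e.symm
  have iso : G ≃g M.insertRoot.graph := SimpleGraph.Iso.comap e.symm _
  have hadj : ∀ p q, G.Adj p q ↔ p ≠ q ∧ ∃ d, M.insertRootOrigin d = p ∧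
      M.insertRootOrigin (M.insertRoot.α d) = q := by
    intro p q
    refine and_congr e.symm.injective.ne_iff (exists_congr fun d => and_congr ?_ ?_)
    · exact e.eq_symm_apply.trans (by rfl)
    · exact e.eq_symm_apply.trans (by rfl)
  rw [← SimpleGraph.noCutVertex_option_iff (G := G) (H := M.graph) (a := M.origin M.root)
    (b := M.target M.root)]
  · exact ⟨fun h => h.of_iso iso.symm, fun h => h.of_iso iso⟩
  · intro x y
    rw [hadj]
    refine and_congr (Option.some_injective _).ne_iff ⟨?_, ?_⟩
    · rintro ⟨d | t, h1, h2⟩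
      · rw [insertRootOrigin_α_inl] at h2
        exact ⟨d, Option.some_injective _ h1, Option.some_injective _ h2⟩
      · rw [insertRootOrigin_α_inr] at h2
        cases t with
        | wu => exact ⟨M.root, Option.some_injective _ h1, Option.some_injective _ h2⟩
        | uw =>
          refine ⟨M.α M.root, Option.some_injective _ h1, ?_⟩
          rw [target, M.α_α]
          exact Option.some_injective _ h2
        | uv => cases h2
        | wv => cases h2
        | _ => cases h1
    · rintro ⟨d, rfl, rfl⟩
      exact ⟨Sum.inl d, rfl, M.insertRootOrigin_α_inl d⟩
  · intro x
    rw [hadj]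
    refine ⟨?_, ?_⟩
    · rintro ⟨-, d | t, h1, h2⟩
      · cases h1
      · rw [insertRootOrigin_α_inr] at h2
        cases t with
        | vw => exact Or.inl (Option.some_injective _ h2).symm
        | vu => exact Or.inr (Option.some_injective _ h2).symm
        | _ => cases h1
    · rintro (rfl | rfl)
      · exact ⟨(Option.some_ne_none _).symm, Sum.inr vw, rfl, M.insertRootOrigin_α_inr vw⟩
      · exact ⟨(Option.some_ne_none _).symm, Sum.inr vu, rfl, M.insertRootOrigin_α_inr vu⟩
  · exact ⟨hloop, M.root, rfl, rfl⟩

theorem insertRoot_isNonSepTriangulation_iff [Finite D] :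
    M.insertRoot.IsNonSepTriangulation ↔ M.IsNonSepTriangulation := by
  have : Finite M.Vertex := Finite.of_surjective _ M.origin_surjective
  rw [isNonSepTriangulation_iff, isNonSepTriangulation_iff, insertRoot_loopless_iff,
    Nat.card_congr M.insertRootVertexEquiv, Finite.card_option, Nat.card_sum]
  have h6 : Nat.card TriangleDart = 6 := by
    rw [Nat.card_eq_fintype_card]; rfl
  have htri : (∀ d, M.insertRoot.φ (M.insertRoot.φ (M.insertRoot.φ d)) = d ∧
      M.insertRoot.φ d ≠ d) ↔ ∀ d, M.φ (M.φ (M.φ d)) = d ∧ M.φ d ≠ d := by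
    rw [Sum.forall]
    simp only [insertRoot_φ_inl, insertRoot_φ_inr, Sum.inl.injEq, Sum.inr.injEq, ne_eq]
    exact and_iff_left (by decide)
  rw [h6, htri, and_left_comm, and_left_comm (a := M.graph.NoCutVertex)]
  refine and_congr (by omega) ?_
  rw [and_left_comm, and_left_comm (a := M.graph.NoCutVertex)]
  refine and_congr_right fun hloop => and_congr_left fun _ => ?_
  exact M.insertRoot_noCutVertex_iff (hloop _)

theorem insertRoot_vertexDegree (d : D ⊕ TriangleDart) :
    M.insertRoot.vertexDegree (M.insertRoot.origin d) =
      {x | M.insertRootOrigin x = M.insertRootOrigin d}.ncard := by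
  rw [vertexDegree]
  congr 1
  ext x
  exact M.insertRootVertexEquiv.injective.eq_iff.symm

theorem insertRoot_vertexDegree_origin_root :
    M.insertRoot.vertexDegree (M.insertRoot.origin M.insertRoot.root) = 2 := by
  rw [insertRoot_root, insertRoot_vertexDegree, Set.ncard_eq_two]
  refine ⟨Sum.inr vu, Sum.inr vw, by simp, ?_⟩
  ext (d | t)
  · simp [insertRootOrigin]
  · cases t <;> simp [insertRootOrigin]

theorem three_le_insertRoot_vertexDegree_root [Finite D] :
    3 ≤ M.insertRoot.vertexDegree (M.insertRoot.origin (Sum.inl M.root)) := by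
  rw [insertRoot_vertexDegree, Nat.succ_le_iff, Set.two_lt_ncard_iff]
  exact ⟨Sum.inl M.root, Sum.inr wv, Sum.inr wu, rfl, rfl, rfl, by simp, by simp, by simp⟩

theorem three_le_insertRoot_vertexDegree_α_root [Finite D] :
    3 ≤ M.insertRoot.vertexDegree (M.insertRoot.origin (Sum.inl (M.α M.root))) := by
  rw [insertRoot_vertexDegree, Nat.succ_le_iff, Set.two_lt_ncard_iff]
  exact ⟨Sum.inl (M.α M.root), Sum.inr uv, Sum.inr uw, rfl, rfl, rfl, by simp, by simp,
    by simp⟩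

theorem insertRoot_vertexDegree_inl {d : D} (h : ¬ M.IncidentToRoot (M.origin d)) :
    M.insertRoot.vertexDegree (M.insertRoot.origin (Sum.inl d)) =
      M.vertexDegree (M.origin d) := by
  rw [insertRoot_vertexDegree, vertexDegree,
    ← Set.ncard_image_of_injective {x | M.origin x = M.origin d}
      (Sum.inl_injective (β := TriangleDart))]
  congr 1
  rw [IncidentToRoot, not_or] at h
  ext (x | t)
  · rw [Sum.inl_injective.mem_set_image]
    exact (Option.some_injective _).eq_iff
  · refine iff_of_false ?_ (by simp)
    cases t with
    | wv => exact fun h' => h.1 (Option.some_injective _ h').symm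
    | wu => exact fun h' => h.1 (Option.some_injective _ h').symm
    | uv => exact fun h' => h.2 (Option.some_injective _ h').symm
    | uw => exact fun h' => h.2 (Option.some_injective _ h').symm
    | _ => exact fun h' => by cases h'

theorem insertRoot_target_root :
    M.insertRoot.target M.insertRoot.root = M.insertRoot.origin (Sum.inl (M.α M.root)) := by
  rw [insertRoot_root, target, M.insertRoot_α_inr (by decide) (by decide)]
  exact M.insertRoot_origin_uv

end InsertRoot

/-- The maps counted by `triangulationsG`: non-separable triangulations in which every vertex not
incident to the root has degree at least 3. -/
def IsTypeG {D : Type} (M : RootedCombMap D) : Prop :=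
  M.IsNonSepTriangulation ∧ ∀ v : M.Vertex, ¬ M.IncidentToRoot v → 3 ≤ M.vertexDegree v

theorem insertRoot_isTypeG_iff {D : Type} [Finite D] (M : RootedCombMap D) :
    M.insertRoot.IsTypeG ↔ M.IsTypeG := by
  refine and_congr M.insertRoot_isNonSepTriangulation_iff ⟨fun h v hv => ?_, fun h v hv => ?_⟩
  · obtain ⟨d, rfl⟩ := M.origin_surjective v
    rw [← M.insertRoot_vertexDegree_inl hv]
    apply h
    rw [IncidentToRoot, not_or, insertRoot_target_root, insertRoot_root]
    rw [IncidentToRoot, not_or] at hv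
    constructor
    · intro h'
      cases congrArg M.insertRootVertexEquiv h'
    · intro h'
      exact hv.2 (Option.some_injective _ (congrArg M.insertRootVertexEquiv h'))
  · obtain ⟨v, rfl⟩ := M.insertRootVertexEquiv.symm.surjective v
    rcases v with _ | v
    · exact absurd (Or.inl rfl) hv
    obtain ⟨d, rfl⟩ := M.origin_surjective v
    rw [insertRootVertexEquiv_symm_some] at hv ⊢
    by_cases hd : M.IncidentToRoot (M.origin d)
    · rcases hd with hd | hd
      · rw [← insertRootVertexEquiv_symm_some, hd]
        exact M.three_le_insertRoot_vertexDegree_root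
      · rw [← insertRootVertexEquiv_symm_some, hd]
        exact M.three_le_insertRoot_vertexDegree_α_root
    · rw [M.insertRoot_vertexDegree_inl hd]
      exact h _ hd

end RootedCombMap

/-! ### Maps that arise by insertion -/

namespace RootedCombMap

open TriangleDart

variable {D D' : Type}

/-- A bijection that commutes with the face permutation and the reversal commutes with the vertex
permutation. -/
theorem IsIso.of_φ_α {e : D ≃ D'} {M : RootedCombMap D} {N : RootedCombMap D'}
    (hφ : ∀ d, e (M.φ d) = N.φ (e d)) (hα : ∀ d, e (M.α d) = N.α (e d))
    (hroot : e M.root = N.root) : IsIso e M N where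
  map_σ d := by rw [← φ_α, hφ, hα, φ_α]
  map_α := hα
  map_root := hroot

theorem IsIso.insertRoot {e : D ≃ D'} {M : RootedCombMap D} {N : RootedCombMap D'}
    (h : IsIso e M N) :
    IsIso (e.sumCongr (Equiv.refl TriangleDart)) M.insertRoot N.insertRoot := by
  classical
  set e' := e.sumCongr (Equiv.refl TriangleDart) with he'
  have hwu : e' (Sum.inr wu) = Sum.inr wu := rfl
  have hroot : e' (Sum.inl M.root) = Sum.inl N.root := congrArg Sum.inl h.map_root
  refine IsIso.of_φ_α ?_ ?_ rfl
  · rintro (d | t)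
    · rw [insertRoot_φ_inl]
      exact (congrArg Sum.inl (h.map_φ d)).trans (N.insertRoot_φ_inl (e d)).symm
    · rw [insertRoot_φ_inr]
      exact (N.insertRoot_φ_inr t).symm
  · intro d
    have hmid : ∀ x, e' (Equiv.sumCongr M.α reverse x) = Equiv.sumCongr N.α reverse (e' x) := by
      rintro (x | t)
      · exact congrArg Sum.inl (h.map_α x)
      · rfl
    rw [insertRoot_α_apply, insertRoot_α_apply, e'.injective.map_swap, hmid,
      e'.injective.map_swap, hwu, hroot]

/-- A permutation of a sum that preserves the second summand splits. -/
theorem exists_eq_sumCongr {T : Type} [Finite D] [Finite T] {π : Equiv.Perm (D ⊕ T)}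
    {τ : Equiv.Perm T} (h : ∀ t, π (Sum.inr t) = Sum.inr (τ t)) :
    ∃ ρ : Equiv.Perm D, π = Equiv.sumCongr ρ τ := by
  have hmaps : Set.MapsTo π (Set.range Sum.inl) (Set.range Sum.inl) := by
    rw [Equiv.Perm.perm_mapsTo_inl_iff_mapsTo_inr]
    rintro _ ⟨t, rfl⟩
    exact ⟨τ t, (h t).symm⟩
  obtain ⟨⟨ρ, τ'⟩, rfl⟩ := Equiv.Perm.mem_sumCongrHom_range_of_perm_mapsTo_inl hmaps
  refine ⟨ρ, Equiv.ext ?_⟩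
  rintro (d | t)
  · rfl
  · exact h t

/-- The root of the enlarged map determines all six inserted darts, so that the insertion can be
undone. -/
theorem IsIso.of_insertRoot [Finite D] {M N : RootedCombMap D}
    {e : D ⊕ TriangleDart ≃ D ⊕ TriangleDart} (h : IsIso e M.insertRoot N.insertRoot) :
    ∃ e' : D ≃ D, IsIso e' M N := by
  classical
  have hvu : e (Sum.inr vu) = Sum.inr vu := h.map_root
  have hφ : ∀ t, e (Sum.inr t) = Sum.inr t → e (Sum.inr (rotate t)) = Sum.inr (rotate t) := by
    intro t ht
    rw [← M.insertRoot_φ_inr, h.map_φ, ht, insertRoot_φ_inr, insertRoot_φ_inr]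
  have huw : e (Sum.inr uw) = Sum.inr uw := hφ vu hvu
  have hwv : e (Sum.inr wv) = Sum.inr wv := hφ uw huw
  have huv : e (Sum.inr uv) = Sum.inr uv := by
    have h1 := h.map_α (Sum.inr vu)
    rwa [hvu, M.insertRoot_α_inr (by decide) (by decide),
      N.insertRoot_α_inr (by decide) (by decide)] at h1
  have hvw : e (Sum.inr vw) = Sum.inr vw := hφ uv huv
  have hwu : e (Sum.inr wu) = Sum.inr wu := hφ vw hvw
  obtain ⟨e', he'⟩ := exists_eq_sumCongr (π := e) (τ := Equiv.refl TriangleDart) (by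
    rintro ⟨⟩ <;> assumption)
  have hinl : ∀ d, e (Sum.inl d) = Sum.inl (e' d) := fun d => by rw [he']; rfl
  have hroot : e' M.root = N.root := by
    apply Sum.inl_injective (β := TriangleDart)
    rw [← hinl, ← insertRoot_α_uw, h.map_α, huw, insertRoot_α_uw]
  refine ⟨e', IsIso.of_φ_α (fun d => ?_) (fun d => ?_) hroot⟩
  · apply Sum.inl_injective (β := TriangleDart)
    rw [← hinl, ← insertRoot_φ_inl, h.map_φ, hinl, insertRoot_φ_inl]
  · have hαroot : e' (M.α M.root) = N.α N.root := by
      apply Sum.inl_injective (β := TriangleDart)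
      rw [← hinl, ← insertRoot_α_wu, h.map_α, hwu, insertRoot_α_wu]
    by_cases h1 : d = M.root
    · rw [h1, hαroot, hroot]
    by_cases h2 : d = M.α M.root
    · rw [h2, M.α_α, hαroot, N.α_α, hroot]
    apply Sum.inl_injective (β := TriangleDart)
    rw [← hinl, ← M.insertRoot_α_inl h1 h2, h.map_α, hinl, N.insertRoot_α_inl]
    · rwa [← hroot, e'.injective.ne_iff]
    · rwa [← hαroot, e'.injective.ne_iff]

/-- A map whose root is the dart `vu` of a triangle glued on as in `insertRoot` arises by
insertion. -/
theorem exists_isIso_insertRoot_of_sum [Finite D] (P : RootedCombMap (D ⊕ TriangleDart))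
    (hφ : ∀ t, P.φ (Sum.inr t) = Sum.inr (rotate t))
    (hα : ∀ t, t ≠ wu → t ≠ uw → P.α (Sum.inr t) = Sum.inr (reverse t))
    {a : D} (ha : P.α (Sum.inr wu) = Sum.inl a) (hroot : P.root = Sum.inr vu) :
    ∃ N : RootedCombMap D, IsIso (Equiv.refl _) P N.insertRoot := by
  classical
  obtain ⟨b, hb⟩ : ∃ b, P.α (Sum.inr uw) = Sum.inl b := by
    rcases hx : P.α (Sum.inr uw) with b | t
    · exact ⟨b, rfl⟩
    · exfalso
      have ht : P.α (Sum.inr t) = Sum.inr uw := by rw [← hx, P.α_α]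
      by_cases h1 : t = wu
      · rw [h1, ha] at ht
        cases ht
      by_cases h2 : t = uw
      · rw [h2] at ht
        exact P.α_ne _ ht
      · rw [hα t h1 h2] at ht
        apply h1
        rw [← reverse_reverse t, Sum.inr_injective ht]
        rfl
  have hb' : P.α (Sum.inl b) = Sum.inr uw := by rw [← hb, P.α_α]
  let s : Equiv.Perm (D ⊕ TriangleDart) := Equiv.swap (Sum.inr wu) (Sum.inl b)
  have hs : ∀ x, s (s x) = x := fun x => Equiv.swap_apply_self _ _ x
  have hst : ∀ t, t ≠ wu → s (Sum.inr t) = Sum.inr t := fun t ht =>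
    Equiv.swap_apply_of_ne_of_ne (by simpa using ht) (by simp)
  have hswu : s (Sum.inr wu) = Sum.inl b := Equiv.swap_apply_left _ _
  have hsb : s (Sum.inl b) = Sum.inr wu := Equiv.swap_apply_right _ _
  obtain ⟨φ', hφ'⟩ := exists_eq_sumCongr hφ
  obtain ⟨α', hα'⟩ := exists_eq_sumCongr (π := s * P.α * s) (τ := reverse) (by
    intro t
    rw [Equiv.Perm.mul_apply, Equiv.Perm.mul_apply]
    by_cases h1 : t = wu
    · rw [h1, hswu, hb', hst _ (by decide)]; rfl
    rw [hst t h1]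
    by_cases h2 : t = uw
    · rw [h2, hb, hsb]; rfl
    · rw [hα t h1 h2, hst]
      exact fun h => h2 (by rw [← reverse_reverse t, h]; rfl))
  have hα'_inl : ∀ d, Sum.inl (α' d) = s (P.α (s (Sum.inl d))) := fun d =>
    (Equiv.congr_fun hα' (Sum.inl d)).symm
  let N : RootedCombMap D :=
    { σ := φ' * α'
      α := α'
      α_α := fun d => by
        apply Sum.inl_injective (β := TriangleDart)
        rw [hα'_inl, hα'_inl, hs, P.α_α, hs]
      α_ne := fun d h => by
        have h1 := hα'_inl d
        rw [h, ← s.symm_apply_eq] at h1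
        exact P.α_ne _ h1.symm
      root := b }
  have hNφ : N.φ = φ' := by
    ext d
    exact congrArg φ' (N.α_α d)
  refine ⟨N, IsIso.of_φ_α (fun d => ?_) (fun d => ?_) hroot⟩
  · rw [insertRoot_φ, hNφ, ← hφ']
    rfl
  · rw [insertRoot_α_apply]
    change P.α d = s (Equiv.sumCongr α' reverse (s d))
    rw [← hα', Equiv.Perm.mul_apply, Equiv.Perm.mul_apply, hs, hs]

theorem vertexDegree_origin_le_two [Finite D] (M : RootedCombMap D) {d : D}
    (h : M.σ (M.σ d) = d) : M.vertexDegree (M.origin d) ≤ 2 := by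
  have h1 : M.vertexDegree (M.origin d) = Function.minimalPeriod M.σ d :=
    M.σ.ncard_cycle_eq_minimalPeriod d
  rw [h1]
  exact Function.IsPeriodicPt.minimalPeriod_le (n := 2) two_pos h

/-- If the origin `v` of the root has degree 2, the two faces at `v` are triangles with the same
corners `u`, `v`, `w`, and their sides opposite to `v` are two edges between `u` and `w`. These edges
are distinct, since `w` has degree at least 3; merging them and deleting `v` undoes an insertion. -/
theorem IsTypeG.exists_isIso_insertRoot [Finite D] [Finite D'] {M : RootedCombMap D}
    (h : M.IsTypeG) (hdeg : M.vertexDegree (M.origin M.root) < 3)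
    (hcard : Nat.card D = Nat.card D' + 6) :
    ∃ (e : D ≃ D' ⊕ TriangleDart) (N : RootedCombMap D'), IsIso e M N.insertRoot := by
  obtain ⟨hM, hG⟩ := h
  obtain ⟨hσ, hσ_ne⟩ := hM.σ_σ_eq hdeg
  obtain ⟨-, -, hloop, htri⟩ := M.isNonSepTriangulation_iff.1 hM
  set r := M.root with hr
  let j : TriangleDart → D := fun t => match t with
    | vu => r
    | vw => M.σ r
    | uv => M.α r
    | wv => M.α (M.σ r)
    | uw => M.φ r
    | wu => M.φ (M.σ r)
  have hφ_uv : M.φ (M.α r) = M.σ r := M.φ_α r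
  have hφ_wv : M.φ (M.α (M.σ r)) = r := by rw [M.φ_α, hσ]
  have hφ_wu : M.φ (M.φ (M.σ r)) = M.α r := by rw [← hφ_uv]; exact (htri _).1
  have hφ_uw : M.φ (M.φ r) = M.α (M.σ r) := by
    have h1 := (htri (M.α (M.σ r))).1
    rwa [hφ_wv] at h1
  have hjφ : ∀ t, M.φ (j t) = j (rotate t) := by
    rintro ⟨⟩
    exacts [hφ_uv, rfl, hφ_wu, rfl, hφ_wv, hφ_uw]
  have hjα : ∀ t, t ≠ wu → t ≠ uw → M.α (j t) = j (reverse t) := by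
    rintro ⟨⟩ h1 h2
    exacts [M.α_α r, rfl, absurd rfl h1, rfl, M.α_α _, absurd rfl h2]
  -- the corners `u`, `v`, `w` are distinct because there is no loop
  have hvu : M.origin r ≠ M.origin (M.α r) := hloop r
  have hvw : M.origin r ≠ M.origin (M.α (M.σ r)) := by
    rw [← M.origin_σ r]
    exact hloop (M.σ r)
  have huw : M.origin (M.α r) ≠ M.origin (M.α (M.σ r)) := by
    have h1 := hloop (M.φ r)
    rwa [← M.origin_φ, hφ_uw, M.origin_φ] at h1
  let src : TriangleDart → M.Vertex := fun t => match t with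
    | vu => M.origin r
    | vw => M.origin r
    | uv => M.origin (M.α r)
    | uw => M.origin (M.α r)
    | wv => M.origin (M.α (M.σ r))
    | wu => M.origin (M.α (M.σ r))
  have horigin : ∀ t, M.origin (j t) = src t := by
    rintro ⟨⟩
    exacts [rfl, M.origin_σ r, M.origin_φ (M.σ r), rfl, rfl, M.origin_φ r]
  have hj_inj : Function.Injective j := by
    intro s t hst
    have h1 : src s = src t := by rw [← horigin, ← horigin, hst]
    have h2 : src (rotate s) = src (rotate t) := by
      rw [← horigin, ← horigin, ← hjφ, ← hjφ, hst]
    cases s <;> cases t <;> first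
      | rfl
      | exact absurd h1 hvu | exact absurd h1 hvw | exact absurd h1 huw
      | exact absurd h1.symm hvu | exact absurd h1.symm hvw | exact absurd h1.symm huw
      | exact absurd h2 hvu | exact absurd h2 hvw | exact absurd h2 huw
      | exact absurd h2.symm hvu | exact absurd h2.symm hvw | exact absurd h2.symm huw
  -- otherwise `w` would have degree 2
  have hα_ne : M.α (j wu) ≠ j uw := by
    intro h1
    have h2 : M.σ (j wv) = j wu := by
      rw [← M.φ_α]
      exact congrArg M.φ (M.α_α _)
    have h3 : M.σ (j wu) = j wv := by
      rw [← M.φ_α, h1]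
      exact hjφ uw
    have h4 := M.vertexDegree_origin_le_two (d := j wv) (by rw [h2, h3])
    have h5 := hG (M.origin (j wv)) (by
      rintro (h6 | h6)
      · exact hvw h6.symm
      · exact huw h6.symm)
    omega
  have hα_wu : ∀ t, M.α (j wu) ≠ j t := by
    intro t ht
    by_cases h1 : t = wu
    · rw [h1] at ht
      exact M.α_ne _ ht
    by_cases h2 : t = uw
    · rw [h2] at ht
      exact hα_ne ht
    have h3 := hjα t h1 h2
    rw [← ht, M.α_α] at h3
    apply h2
    rw [← reverse_reverse t, ← @hj_inj wu (reverse t) h3]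
    rfl
  classical
  have h6 : Nat.card TriangleDart = 6 := by
    rw [Nat.card_eq_fintype_card]; rfl
  have hcompl : Nat.card ((Set.range j)ᶜ : Set D) = Nat.card D' := by
    have h1 := Nat.card_congr (Equiv.Set.sumCompl (Set.range j))
    rw [Nat.card_sum, ← Nat.card_congr (Equiv.ofInjective j hj_inj), h6] at h1
    omega
  obtain ⟨ε⟩ : Nonempty (((Set.range j)ᶜ : Set D) ≃ D') :=
    ⟨(Finite.equivFinOfCardEq hcompl).trans (Finite.equivFinOfCardEq rfl).symm⟩
  let e : D ≃ D' ⊕ TriangleDart := (Equiv.Set.sumCompl (Set.range j)).symm.trans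
    ((Equiv.sumCongr (Equiv.ofInjective j hj_inj).symm ε).trans (Equiv.sumComm _ _))
  have he : ∀ t, e (j t) = Sum.inr t := fun t => by
    rw [← Equiv.eq_symm_apply]
    rfl
  have hiso := isIso_relabel e M
  obtain ⟨a, ha⟩ : ∃ a, e (M.α (j wu)) = Sum.inl a := by
    rcases hx : e (M.α (j wu)) with a | t
    · exact ⟨a, rfl⟩
    · exact absurd (e.injective (hx.trans (he t).symm)) (hα_wu t)
  obtain ⟨N, hN⟩ := exists_isIso_insertRoot_of_sum (M.relabel e)
    (fun t => by rw [← he, ← hiso.map_φ, hjφ, he])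
    (fun t h1 h2 => by rw [← he, ← hiso.map_α, hjα t h1 h2, he])
    (a := a) (by rw [← he, ← hiso.map_α, ha]) (he vu)
  exact ⟨_, N, hiso.trans hN⟩

/-! ### Reversal of the root -/

/-- The same map with its root edge oriented the other way. -/
def reverseRoot (M : RootedCombMap D) : RootedCombMap D := { M with root := M.α M.root }

theorem reverseRoot_reverseRoot (M : RootedCombMap D) : M.reverseRoot.reverseRoot = M := by
  have h : M.α (M.α M.root) = M.root := M.α_α _
  obtain ⟨σ, α, h1, h2, r⟩ := M
  simp only [reverseRoot] at h ⊢
  rw [h]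

theorem IsIso.reverseRoot {e : D ≃ D'} {M : RootedCombMap D} {N : RootedCombMap D'}
    (h : IsIso e M N) : IsIso e M.reverseRoot N.reverseRoot where
  map_σ := h.map_σ
  map_α := h.map_α
  map_root := (h.map_α M.root).trans (congrArg N.α h.map_root)

theorem reverseRoot_target_root (M : RootedCombMap D) :
    M.reverseRoot.target M.reverseRoot.root = M.origin M.root :=
  congrArg M.origin (M.α_α M.root)

theorem IsTypeG.reverseRoot [Finite D] {M : RootedCombMap D} (h : M.IsTypeG) :
    M.reverseRoot.IsTypeG := by
  refine ⟨?_, fun v hv => h.2 v fun hv' => hv ?_⟩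
  · rw [isNonSepTriangulation_iff]
    exact M.isNonSepTriangulation_iff.1 h.1
  · rcases hv' with hv' | hv'
    · exact Or.inr (hv'.trans M.reverseRoot_target_root.symm)
    · exact Or.inl hv'

theorem IsIso.isTypeG [Finite D] {e : D ≃ D'} {M : RootedCombMap D} {N : RootedCombMap D'}
    (h : IsIso e M N) (hM : M.IsTypeG) : N.IsTypeG := by
  refine ⟨h.isNonSepTriangulation hM.1, fun v hv => ?_⟩
  obtain ⟨v, rfl⟩ := h.vertexEquiv.surjective v
  rw [h.vertexDegree_eq]
  exact hM.2 v fun hv' => hv ((h.incidentToRoot_iff v).2 hv')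

theorem IsIso.vertexDegree_origin_root {e : D ≃ D'} {M : RootedCombMap D}
    {N : RootedCombMap D'} (h : IsIso e M N) :
    N.vertexDegree (N.origin N.root) = M.vertexDegree (M.origin M.root) := by
  rw [← h.map_root, ← h.vertexEquiv_origin, h.vertexDegree_eq]

theorem IsIso.vertexDegree_target_root {e : D ≃ D'} {M : RootedCombMap D}
    {N : RootedCombMap D'} (h : IsIso e M N) :
    N.vertexDegree (N.target N.root) = M.vertexDegree (M.target M.root) := by
  rw [← h.map_root, ← h.vertexEquiv_target, h.vertexDegree_eq]

end RootedCombMap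

/-! ### Counting classes of maps -/

open RootedCombMap

namespace RootedMapClass

variable {m : ℕ}

instance : Finite (RootedMapClass m) := by
  have : Finite (RootedCombMap (Fin (2 * m))) := by
    refine Finite.of_injective (fun M => (M.σ, M.α, M.root)) ?_
    rintro ⟨σ, α, h1, h2, r⟩ ⟨σ', α', h1', h2', r'⟩ h
    simp only [Prod.mk.injEq] at h
    obtain ⟨rfl, rfl, rfl⟩ := h
    rfl
  exact Quotient.finite _

theorem mk_eq_mk_iff {M N : RootedCombMap (Fin (2 * m))} :
    mk M = mk N ↔ ∃ e, IsIso e M N := by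
  refine (Quotient.eq (r := isoSetoid _)).trans (exists_congr fun e => ?_)
  exact ⟨fun ⟨h1, h2, h3⟩ => ⟨h1, h2, h3⟩, fun ⟨h1, h2, h3⟩ => ⟨h1, h2, h3⟩⟩

theorem mk_surjective : Function.Surjective (mk (m := m)) := Quotient.mk_surjective

theorem mk_mem_image_iff {p : RootedCombMap (Fin (2 * m)) → Prop}
    (hp : ∀ e M N, IsIso e M N → p M → p N) (M : RootedCombMap (Fin (2 * m))) :
    mk M ∈ mk '' {M | p M} ↔ p M := by
  refine ⟨?_, fun h => ⟨M, h, rfl⟩⟩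
  rintro ⟨N, hN, hNM⟩
  obtain ⟨e, he⟩ := mk_eq_mk_iff.1 hNM
  exact hp e N M he hN

/-- A labelling of the darts of a map with `m` edges and of the six inserted darts. -/
noncomputable def insertRootLabelling (m : ℕ) : Fin (2 * m) ⊕ TriangleDart ≃ Fin (2 * (m + 3)) :=
  Fintype.equivOfCardEq (by
    have h6 : Fintype.card TriangleDart = 6 := rfl
    rw [Fintype.card_sum, Fintype.card_fin, Fintype.card_fin, h6]
    omega)

/-- The insertion `RootedCombMap.insertRoot` up to relabelling of the darts. -/
noncomputable def insertRoot : RootedMapClass m → RootedMapClass (m + 3) :=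
  Quotient.lift (fun M => mk (M.insertRoot.relabel (insertRootLabelling m))) fun _ _ h => by
    obtain ⟨e, he⟩ := mk_eq_mk_iff.1 (Quotient.sound h)
    exact mk_eq_mk_iff.2
      ⟨_, ((isIso_relabel _ _).symm.trans he.insertRoot).trans (isIso_relabel _ _)⟩

theorem insertRoot_mk (M : RootedCombMap (Fin (2 * m))) :
    insertRoot (mk M) = mk (M.insertRoot.relabel (insertRootLabelling m)) := rfl

theorem insertRoot_injective : Function.Injective (insertRoot (m := m)) := by
  intro c c' h
  obtain ⟨M, rfl⟩ := mk_surjective c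
  obtain ⟨N, rfl⟩ := mk_surjective c'
  obtain ⟨e, he⟩ := mk_eq_mk_iff.1 h
  exact mk_eq_mk_iff.2
    (((isIso_relabel _ _).trans he).trans (isIso_relabel _ _).symm).of_insertRoot

/-- Reversal of the root up to relabelling of the darts. -/
def reverseRoot : RootedMapClass m → RootedMapClass m :=
  Quotient.lift (fun M => mk M.reverseRoot) fun _ _ h => by
    obtain ⟨e, he⟩ := mk_eq_mk_iff.1 (Quotient.sound h)
    exact mk_eq_mk_iff.2 ⟨e, he.reverseRoot⟩

theorem reverseRoot_mk (M : RootedCombMap (Fin (2 * m))) :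
    reverseRoot (mk M) = mk M.reverseRoot := rfl

theorem reverseRoot_injective : Function.Injective (reverseRoot (m := m)) := by
  refine Function.Involutive.injective fun c => ?_
  obtain ⟨M, rfl⟩ := mk_surjective c
  rw [reverseRoot_mk, reverseRoot_mk, reverseRoot_reverseRoot]

end RootedMapClass

open RootedMapClass

/-- Maps counted by `triangulationsG` whose root starts at a vertex of degree less than 3. -/
def triangulationsGSmallOrigin (m : ℕ) : Set (RootedMapClass m) :=
  mk '' {M | M.IsTypeG ∧ M.vertexDegree (M.origin M.root) < 3}

/-- Maps counted by `triangulationsG` whose root ends at a vertex of degree less than 3. -/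
def triangulationsGSmallTarget (m : ℕ) : Set (RootedMapClass m) :=
  mk '' {M | M.IsTypeG ∧ M.vertexDegree (M.target M.root) < 3}

section Count

variable {m : ℕ} (M : RootedCombMap (Fin (2 * m)))

theorem mk_mem_triangulationsG : mk M ∈ triangulationsG m ↔ M.IsTypeG :=
  mk_mem_image_iff (fun _ _ _ he h => he.isTypeG h) M

theorem mk_mem_triangulationsGSmallOrigin : mk M ∈ triangulationsGSmallOrigin m ↔
    M.IsTypeG ∧ M.vertexDegree (M.origin M.root) < 3 :=
  mk_mem_image_iff (fun _ _ _ he h =>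
    ⟨he.isTypeG h.1, he.vertexDegree_origin_root.trans_lt h.2⟩) M

theorem mk_mem_triangulationsGSmallTarget : mk M ∈ triangulationsGSmallTarget m ↔
    M.IsTypeG ∧ M.vertexDegree (M.target M.root) < 3 :=
  mk_mem_image_iff (fun _ _ _ he h =>
    ⟨he.isTypeG h.1, he.vertexDegree_target_root.trans_lt h.2⟩) M

theorem mk_mem_triangulationsGStar : mk M ∈ triangulationsGStar m ↔
    M.IsTypeG ∧ 3 ≤ M.vertexDegree (M.origin M.root) ∧
      3 ≤ M.vertexDegree (M.target M.root) := by
  refine (mk_mem_image_iff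
    (p := fun M => M.IsNonSepTriangulation ∧ ∀ v : M.Vertex, 3 ≤ M.vertexDegree v)
    (fun e M N he h => ⟨he.isNonSepTriangulation h.1, fun v => ?_⟩)
    M).trans ⟨fun h => ⟨⟨h.1, fun v _ => h.2 v⟩, h.2 _, h.2 _⟩, fun h => ⟨h.1.1, fun v => ?_⟩⟩
  · obtain ⟨v, rfl⟩ := he.vertexEquiv.surjective v
    rw [he.vertexDegree_eq]
    exact h.2 v
  · by_cases hv : M.IncidentToRoot v
    · rcases hv with rfl | rfl
      · exact h.2.1
      · exact h.2.2
    · exact h.1.2 v hv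

end Count

theorem image_insertRoot_triangulationsG (m : ℕ) :
    RootedMapClass.insertRoot '' triangulationsG m = triangulationsGSmallOrigin (m + 3) := by
  ext c
  constructor
  · rintro ⟨c, hc, rfl⟩
    obtain ⟨M, rfl⟩ := mk_surjective c
    rw [mk_mem_triangulationsG] at hc
    have hiso := isIso_relabel (insertRootLabelling m) M.insertRoot
    rw [insertRoot_mk, mk_mem_triangulationsGSmallOrigin, hiso.vertexDegree_origin_root,
      insertRoot_vertexDegree_origin_root]
    exact ⟨hiso.isTypeG (M.insertRoot_isTypeG_iff.2 hc), by norm_num⟩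
  · intro hc
    obtain ⟨M, rfl⟩ := mk_surjective c
    rw [mk_mem_triangulationsGSmallOrigin] at hc
    obtain ⟨e, N, hN⟩ := hc.1.exists_isIso_insertRoot (D' := Fin (2 * m)) hc.2 (by
      rw [Nat.card_fin, Nat.card_fin]
      omega)
    refine ⟨mk N, ?_, ?_⟩
    · rw [mk_mem_triangulationsG, ← insertRoot_isTypeG_iff]
      exact hN.isTypeG hc.1
    · rw [insertRoot_mk, mk_eq_mk_iff]
      exact ⟨_, (isIso_relabel _ _).symm.trans hN.symm⟩

theorem image_reverseRoot_triangulationsGSmallOrigin (m : ℕ) :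
    RootedMapClass.reverseRoot '' triangulationsGSmallOrigin m = triangulationsGSmallTarget m := by
  ext c
  constructor
  · rintro ⟨c, hc, rfl⟩
    obtain ⟨M, rfl⟩ := mk_surjective c
    rw [mk_mem_triangulationsGSmallOrigin] at hc
    rw [reverseRoot_mk, mk_mem_triangulationsGSmallTarget, reverseRoot_target_root]
    exact ⟨hc.1.reverseRoot, hc.2⟩
  · intro hc
    obtain ⟨M, rfl⟩ := mk_surjective c
    rw [mk_mem_triangulationsGSmallTarget] at hc
    refine ⟨mk M.reverseRoot, ?_, ?_⟩
    · rw [mk_mem_triangulationsGSmallOrigin]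
      exact ⟨hc.1.reverseRoot, hc.2⟩
    · rw [reverseRoot_mk, reverseRoot_reverseRoot]

/-- The insertion raises the degrees of both ends of the old root edge, so the new vertex has no
neighbour of degree 2. -/
theorem disjoint_triangulationsGSmallOrigin_triangulationsGSmallTarget (m : ℕ) :
    Disjoint (triangulationsGSmallOrigin (m + 3)) (triangulationsGSmallTarget (m + 3)) := by
  rw [Set.disjoint_left, ← image_insertRoot_triangulationsG]
  rintro _ ⟨c, -, rfl⟩ hc
  obtain ⟨M, rfl⟩ := mk_surjective c
  rw [insertRoot_mk, mk_mem_triangulationsGSmallTarget,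
    (isIso_relabel _ _).vertexDegree_target_root, insertRoot_target_root] at hc
  exact absurd M.three_le_insertRoot_vertexDegree_α_root (not_le.2 hc.2)

theorem triangulationsG_eq_union (m : ℕ) :
    triangulationsG m = triangulationsGStar m ∪
      (triangulationsGSmallOrigin m ∪ triangulationsGSmallTarget m) := by
  ext c
  obtain ⟨M, rfl⟩ := mk_surjective c
  rw [Set.mem_union, Set.mem_union, mk_mem_triangulationsG, mk_mem_triangulationsGStar,
    mk_mem_triangulationsGSmallOrigin, mk_mem_triangulationsGSmallTarget, ← and_or_left,
    ← and_or_left]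
  exact (and_iff_left (by omega)).symm

theorem disjoint_triangulationsGStar (m : ℕ) :
    Disjoint (triangulationsGStar m)
      (triangulationsGSmallOrigin m ∪ triangulationsGSmallTarget m) := by
  rw [Set.disjoint_left]
  intro c
  obtain ⟨M, rfl⟩ := mk_surjective c
  rw [Set.mem_union, mk_mem_triangulationsGStar, mk_mem_triangulationsGSmallOrigin,
    mk_mem_triangulationsGSmallTarget]
  omega

theorem ncard_triangulationsG_add_three (m : ℕ) :
    (triangulationsG (m + 3)).ncard =
      (triangulationsGStar (m + 3)).ncard + 2 * (triangulationsG m).ncard := by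
  rw [triangulationsG_eq_union, Set.ncard_union_eq (disjoint_triangulationsGStar _),
    Set.ncard_union_eq (disjoint_triangulationsGSmallOrigin_triangulationsGSmallTarget m),
    ← image_reverseRoot_triangulationsGSmallOrigin,
    Set.ncard_image_of_injective _ RootedMapClass.reverseRoot_injective,
    ← image_insertRoot_triangulationsG,
    Set.ncard_image_of_injective _ RootedMapClass.insertRoot_injective, two_mul]

/-- A rooted map has at least one edge. -/
theorem RootedMapClass.isEmpty_zero : IsEmpty (RootedMapClass 0) := by
  refine ⟨fun c => ?_⟩
  obtain ⟨M, -⟩ := mk_surjective c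
  exact Fin.elim0 M.root

theorem mainTheorem7 :
    triangulationGF triangulationsGStar =
      (1 - 2 * (PowerSeries.X : PowerSeries ℤ)) * triangulationGF triangulationsG := by
  have hX : (1 - 2 * (PowerSeries.X : PowerSeries ℤ)) * triangulationGF triangulationsG =
      triangulationGF triangulationsG - (PowerSeries.X * triangulationGF triangulationsG +
        PowerSeries.X * triangulationGF triangulationsG) := by ring
  rw [hX]
  ext n
  rw [map_sub, map_add]
  rcases n with _ | k
  · have hempty : ∀ s : Set (RootedMapClass (3 * 0)), s.ncard = 0 := fun s => by
      have : IsEmpty (RootedMapClass (3 * 0)) := RootedMapClass.isEmpty_zero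
      rw [Set.eq_empty_of_isEmpty s, Set.ncard_empty]
    rw [PowerSeries.coeff_zero_X_mul, triangulationGF, triangulationGF, PowerSeries.coeff_mk,
      PowerSeries.coeff_mk, hempty, hempty]
    norm_num
  · rw [PowerSeries.coeff_succ_X_mul, triangulationGF, triangulationGF, PowerSeries.coeff_mk,
      PowerSeries.coeff_mk, PowerSeries.coeff_mk]
    have h := ncard_triangulationsG_add_three (3 * k)
    rw [show 3 * (k + 1) = 3 * k + 3 from rfl, h]
    push_cast
    ring
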